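/- Let $d,k\ge 0$ be integers. Let $h_1,\dots,h_n\colon\mathbb{R}^d\to\mathbb{R}$ be a finite collection of affine functions $h_i(x)=\langle x,g_i\rangle+c_i$ with $g_i\neq 0$. The hyperplane of $h_i$ is $h_i^{-1}(0)$ and its positive side is $h_i^{-1}[0,\infty)$. The collection is called generic if, for each $1\le p\le d$, every $(d-p)$-dimensional affine subspace of $\mathbb{R}^d$ is contained in $h_i^{-1}(0)$ for at most $p$ indices $i$. A chamber is a full-dimensional cell of the arrangement, i.e. a connected component of $\mathbb{R}^d\setminus\bigcup_i h_i^{-1}(0)$, and its heft is the number of indices $i$ such that the chamber lies on the positive side of the hyperplane of $h_i$. Theorem 4.4. If the collection is generic and every chamber has heft at least $k$, then the number of chambers with heft exactly $k$ is at most $\binom{d+k}{d}$. This bound is tight: for all $d\ge 1$ and $k\ge 0$ there is a generic finite collection of such affine functions on $\mathbb{R}^d$ for which every chamber has heft at least $k$ and exactly $\binom{d+k}{d}$ chambers have heft $k$. -/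

import Mathlib

namespace HeftArrangement

/-- The hyperplane `h i = 0` of the `i`-th function of a collection of affine functions. -/
def hyperplane {d n : ℕ} (h : Fin n → (EuclideanSpace ℝ (Fin d) →ᵃ[ℝ] ℝ)) (i : Fin n) :
    Set (EuclideanSpace ℝ (Fin d)) :=
  {x | h i x = 0}

/-- The (closed) positive side of the `i`-th hyperplane. -/
def positiveSide {d n : ℕ} (h : Fin n → (EuclideanSpace ℝ (Fin d) →ᵃ[ℝ] ℝ)) (i : Fin n) :
    Set (EuclideanSpace ℝ (Fin d)) :=
  {x | 0 ≤ h i x}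

/-- The collection is generic: for each `1 ≤ p ≤ d`, at most `p` of the hyperplanes contain a
common `(d - p)`-plane. The hyperplanes are counted with their indices, so (case `p = 1`) no
hyperplane is repeated. Parallel hyperplanes are allowed. -/
def IsGeneric {d n : ℕ} (h : Fin n → (EuclideanSpace ℝ (Fin d) →ᵃ[ℝ] ℝ)) : Prop :=
  ∀ p : ℕ, 1 ≤ p → p ≤ d →
    ∀ P : AffineSubspace ℝ (EuclideanSpace ℝ (Fin d)),
      (P : Set (EuclideanSpace ℝ (Fin d))).Nonempty →
      Module.finrank ℝ P.direction + p = d →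
      Set.ncard {i : Fin n | (P : Set (EuclideanSpace ℝ (Fin d))) ⊆ hyperplane h i} ≤ p

/-- The chambers (full-dimensional open cells) of the arrangement: the connected components of
the complement of the union of the hyperplanes. -/
def chambers {d n : ℕ} (h : Fin n → (EuclideanSpace ℝ (Fin d) →ᵃ[ℝ] ℝ)) :
    Set (Set (EuclideanSpace ℝ (Fin d))) :=
  {C | ∃ x ∈ (⋃ i, hyperplane h i)ᶜ, C = connectedComponentIn (⋃ i, hyperplane h i)ᶜ x}

/-- The heft of a chamber: the number of hyperplanes that have it on their positive side. -/
noncomputable def heft {d n : ℕ} (h : Fin n → (EuclideanSpace ℝ (Fin d) →ᵃ[ℝ] ℝ))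
    (C : Set (EuclideanSpace ℝ (Fin d))) : ℕ :=
  Set.ncard {i : Fin n | C ⊆ positiveSide h i}

end HeftArrangement

/-! A chamber is determined by its set `A` of positive indices, so the upper bound counts the sets
`A` of size `k` that occur. For one small `ε`, each polyhedron where all functions outside `A` are
at most `-ε` is nonempty; let `v A` be its point nearest the origin. By Helly, some `B A` of at most
`d` of these inequalities already forces norm at least `‖v A‖`. If `‖v A‖ ≤ ‖v A'‖` and `A` misses
`B A'`, then strict convexity of the norm gives `v A = v A'`. A generic point near it is positive
only on indices in `A ∩ A'`, and heft at least `k` forces `A = A'`. Hence the pairs `(A, B A)`,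
ordered by norm, satisfy the skew Bollobás condition, and `card_le_of_skew_set_pairs` bounds their
number.

For tightness, points of `ℝ^d` are read as monic polynomials `p` of degree `d`, with functions
`(-1)^(d+i) p(i)` at the nodes `i < 2k+d-1`. If fewer than `k` were positive, there would be `d+1`
nodes of alternating parity with all values negative, and Lagrange's formula would make the leading
coefficient nonpositive. Each `k`-subset `T` of `range (d+k)` prescribes the roots of a polynomial
of heft exactly `k`, and `T` can be recovered from its positive nodes. -/

namespace HeftArrangement

/-! ### Chambers as sign cells. -/

open Filter Topology

variable {d n : ℕ} (h : Fin n → (EuclideanSpace ℝ (Fin d) →ᵃ[ℝ] ℝ))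

/-- The set of indices whose function is positive at `x`. -/
noncomputable def posSet (x : EuclideanSpace ℝ (Fin d)) : Finset (Fin n) :=
  Finset.univ.filter fun i => 0 < h i x

/-- The points on which every function of the collection has the same strict sign as at `x`. -/
def cell (x : EuclideanSpace ℝ (Fin d)) : Set (EuclideanSpace ℝ (Fin d)) :=
  {y | ∀ i, 0 < h i x * h i y}

variable {h}

@[simp] lemma mem_posSet {x : EuclideanSpace ℝ (Fin d)} {i : Fin n} :
    i ∈ posSet h x ↔ 0 < h i x := by
  simp [posSet]

lemma mem_compl_hyperplanes {x : EuclideanSpace ℝ (Fin d)} :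
    x ∈ (⋃ i, hyperplane h i)ᶜ ↔ ∀ i, h i x ≠ 0 := by
  simp [hyperplane]

lemma continuous_affine (i : Fin n) : Continuous (h i) :=
  (h i).continuous_of_finiteDimensional

lemma convex_cell (x : EuclideanSpace ℝ (Fin d)) : Convex ℝ (cell h x) := by
  have : cell h x = ⋂ i, (h i) ⁻¹' {t | 0 < h i x * t} := by
    ext y; simp [cell]
  rw [this]
  refine convex_iInter fun i => Convex.affine_preimage _ ?_
  have := (convex_Ioi (0 : ℝ)).linear_preimage (LinearMap.mulLeft ℝ (h i x))
  exact this

lemma self_mem_cell {x : EuclideanSpace ℝ (Fin d)} (hx : ∀ i, h i x ≠ 0) : x ∈ cell h x :=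
  fun i => mul_self_pos.2 (hx i)

/-- By the intermediate value theorem no function changes sign on a component; conversely the cell
is convex, hence connected. -/
lemma connectedComponentIn_eq_cell {x : EuclideanSpace ℝ (Fin d)} (hx : ∀ i, h i x ≠ 0) :
    connectedComponentIn (⋃ i, hyperplane h i)ᶜ x = cell h x := by
  apply Set.Subset.antisymm
  · intro y hy i
    by_contra hneg
    have hpre : IsPreconnected (h i '' connectedComponentIn (⋃ i, hyperplane h i)ᶜ x) :=
      isPreconnected_connectedComponentIn.image _ (continuous_affine i).continuousOn
    have hxm := mem_connectedComponentIn (mem_compl_hyperplanes.2 hx)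
    have h0 : (0 : ℝ) ∈ h i '' connectedComponentIn (⋃ i, hyperplane h i)ᶜ x := by
      have hord := hpre.ordConnected
      rcases lt_or_gt_of_ne (hx i) with hlt | hlt
      · refine hord.out (Set.mem_image_of_mem _ hxm) (Set.mem_image_of_mem _ hy) ⟨hlt.le, ?_⟩
        by_contra hh
        exact hneg (mul_pos_of_neg_of_neg hlt (not_le.1 hh))
      · refine hord.out (Set.mem_image_of_mem _ hy) (Set.mem_image_of_mem _ hxm) ⟨?_, hlt.le⟩
        by_contra hh
        exact hneg (mul_pos hlt (not_le.1 hh))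
    obtain ⟨z, hz, hz0⟩ := h0
    exact mem_compl_hyperplanes.1 (connectedComponentIn_subset _ _ hz) i hz0
  · refine (convex_cell x).isPreconnected.subset_connectedComponentIn (self_mem_cell hx) ?_
    intro y hy
    exact mem_compl_hyperplanes.2 fun i h0 => by
      have := hy i
      simp [h0] at this

lemma mem_chambers {C : Set (EuclideanSpace ℝ (Fin d))} :
    C ∈ chambers h ↔ ∃ x, (∀ i, h i x ≠ 0) ∧ C = cell h x := by
  constructor
  · rintro ⟨x, hx, rfl⟩
    exact ⟨x, mem_compl_hyperplanes.1 hx,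
      connectedComponentIn_eq_cell (mem_compl_hyperplanes.1 hx)⟩
  · rintro ⟨x, hx, rfl⟩
    exact ⟨x, mem_compl_hyperplanes.2 hx, (connectedComponentIn_eq_cell hx).symm⟩

lemma cell_subset_positiveSide {x : EuclideanSpace ℝ (Fin d)} (hx : ∀ i, h i x ≠ 0) (i : Fin n) :
    cell h x ⊆ positiveSide h i ↔ 0 < h i x :=
  ⟨fun hs => lt_of_le_of_ne (hs (self_mem_cell hx)) (hx i).symm,
    fun hp _ hy => (pos_of_mul_pos_right (hy i) hp.le).le⟩

lemma heft_cell {x : EuclideanSpace ℝ (Fin d)} (hx : ∀ i, h i x ≠ 0) :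
    heft h (cell h x) = (posSet h x).card := by
  rw [heft, ← Set.ncard_coe_finset]
  congr 1
  ext i
  simp [cell_subset_positiveSide hx]

lemma cell_eq_iff {x y : EuclideanSpace ℝ (Fin d)} (hx : ∀ i, h i x ≠ 0) (hy : ∀ i, h i y ≠ 0) :
    cell h x = cell h y ↔ posSet h x = posSet h y := by
  constructor
  · intro he
    ext i
    rw [mem_posSet, mem_posSet, ← cell_subset_positiveSide hx, ← cell_subset_positiveSide hy, he]
  · intro he
    have key : ∀ i, 0 < h i x ↔ 0 < h i y := fun i => by
      rw [← mem_posSet, ← mem_posSet, he]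
    ext z
    refine forall_congr' fun i => ?_
    rcases lt_or_gt_of_ne (hx i) with h1 | h1
    · have h2 : h i y < 0 := lt_of_le_of_ne (not_lt.1 fun hh => h1.not_gt ((key i).2 hh)) (hy i)
      simp [mul_pos_iff, h1, h2, h1.not_gt, h2.not_gt]
    · rw [mul_pos_iff_of_pos_left h1, mul_pos_iff_of_pos_left ((key i).1 h1)]

/-- A point can be moved off all hyperplanes without leaving the open negative sides it is in. -/
lemma exists_posSet_subset {x : EuclideanSpace ℝ (Fin d)} (hx : ∀ i, h i x ≠ 0)
    (v : EuclideanSpace ℝ (Fin d)) :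
    ∃ w, (∀ i, h i w ≠ 0) ∧ ∀ i, h i v < 0 → h i w < 0 := by
  have hval : ∀ i (t : ℝ), h i (AffineMap.lineMap v x t) = h i v + t * (h i x - h i v) := by
    intro i t
    rw [AffineMap.apply_lineMap, AffineMap.lineMap_apply]
    simp [add_comm]
  have hev : ∀ i, ∀ᶠ t in 𝓝[>] (0 : ℝ), h i (AffineMap.lineMap v x t) ≠ 0 ∧
      (h i v < 0 → h i (AffineMap.lineMap v x t) < 0) := by
    intro i
    have hc : Tendsto (fun t : ℝ => h i v + t * (h i x - h i v)) (𝓝[>] 0) (𝓝 (h i v)) := by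
      have : Continuous fun t : ℝ => h i v + t * (h i x - h i v) := by fun_prop
      simpa using (this.tendsto 0).mono_left nhdsWithin_le_nhds
    simp only [hval]
    rcases lt_trichotomy (h i v) 0 with h0 | h0 | h0
    · filter_upwards [hc.eventually (gt_mem_nhds h0)] with t ht
      exact ⟨ht.ne, fun _ => ht⟩
    -- On a hyperplane through `v` the value is `t * h i x`, nonzero because `x` is off every
    -- hyperplane.
    · filter_upwards [self_mem_nhdsWithin] with t ht
      simp only [h0, zero_add, sub_zero, lt_irrefl, false_imp_iff, and_true]
      exact mul_ne_zero (ne_of_gt ht) (hx i)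
    · filter_upwards [hc.eventually (lt_mem_nhds h0)] with t ht
      exact ⟨ht.ne', fun hh => absurd h0 hh.not_gt⟩
  obtain ⟨t, ht⟩ := (eventually_all.2 hev).exists
  exact ⟨_, fun i => (ht i).1, fun i => (ht i).2⟩

end HeftArrangement

/-! ### The skew set pairs inequality, by the polynomial method. -/

namespace HeftArrangement

open Polynomial

/-- The monomial functions of degree `d` on `Fin m → ℝ`. -/
def symMonomial {m d : ℕ} (s : Sym (Fin m) d) (c : Fin m → ℝ) : ℝ :=
  ((s : Multiset (Fin m)).map c).prod

lemma prod_linear_mem_span {m d : ℕ} (u : Fin d → Fin m → ℝ) :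
    (fun c : Fin m → ℝ => ∏ l, ∑ j, u l j * c j) ∈
      Submodule.span ℝ (Set.range (symMonomial (m := m) (d := d))) := by
  have : (fun c : Fin m → ℝ => ∏ l, ∑ j, u l j * c j) =
      ∑ p : Fin d → Fin m, (∏ l, u l (p l)) •
        symMonomial (m := m) (d := d) (Sym.mk (Multiset.map p Finset.univ.val) (by simp)) := by
    ext c
    have hs : ∀ p : Fin d → Fin m, symMonomial (m := m) (d := d)
        (Sym.mk (Multiset.map p Finset.univ.val) (by simp)) c = ∏ l, c (p l) := fun p => by
      simp only [symMonomial, Sym.coe_mk, Multiset.map_map]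
      rfl
    rw [Finset.prod_univ_sum]
    simp only [Finset.sum_apply, Pi.smul_apply, smul_eq_mul, hs, Finset.prod_mul_distrib,
      Fintype.piFinset_univ]
  rw [this]
  exact Submodule.sum_mem _ fun p _ =>
    Submodule.smul_mem _ _ (Submodule.subset_span (Set.mem_range_self _))

/-- A skew version of Bollobás's set pairs inequality. -/
theorem card_le_of_skew_set_pairs {ι : Type*} [Fintype ι] {n k d : ℕ} (A B : ι → Finset (Fin n))
    (r : ι → ℝ) (hA : ∀ i, (A i).card = k) (hB : ∀ i, (B i).card ≤ d)
    (hAB : ∀ i, Disjoint (A i) (B i))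
    (hskew : ∀ i j, i ≠ j → r i ≤ r j → ¬ Disjoint (A i) (B j)) :
    Fintype.card ι ≤ (d + k).choose d := by
  classical
  -- `A i` becomes the coefficient vector of the polynomial vanishing exactly on it, and `B j` the
  -- form multiplying the evaluations at its points. The form of `B j` vanishes at the vector of `A
  -- i` exactly when the sets meet.
  let q : ι → ℝ[X] := fun i => ∏ a ∈ A i, (X - C ((a : ℕ) : ℝ))
  have hqm : ∀ i, (q i).Monic := fun i => monic_prod_of_monic _ _ fun a _ => monic_X_sub_C _
  have hqd : ∀ i, (q i).natDegree = k := fun i => by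
    rw [natDegree_prod_of_monic _ _ fun a _ => monic_X_sub_C _]
    simp only [natDegree_X_sub_C, Finset.sum_const, hA, smul_eq_mul, mul_one]
  let cf : ι → Fin (k + 1) → ℝ := fun i j => (q i).coeff j
  have hq0 : ∀ i (b : Fin n), (q i).eval ((b : ℕ) : ℝ) = 0 ↔ b ∈ A i := by
    intro i b
    simp only [q, eval_prod, eval_sub, eval_X, eval_C, Finset.prod_eq_zero_iff, sub_eq_zero]
    constructor
    · rintro ⟨a, ha, hab⟩
      have : b = a := Fin.ext (by exact_mod_cast hab)
      exact this ▸ ha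
    · exact fun hb => ⟨b, hb, rfl⟩
  have hu : ∀ j, ∃ u : Fin d → Fin (k + 1) → ℝ, ∀ i,
      (∏ l, ∑ t, u l t * cf i t) = ∏ b ∈ B j, (q i).eval ((b : ℕ) : ℝ) := by
    intro j
    let e : Fin (B j).card ≃ B j := (B j).equivFin.symm
    -- When `B j` has fewer than `d` elements, the missing factors read off the leading coefficient,
    -- which is 1; this keeps the form homogeneous of degree `d`.
    refine ⟨fun l t => if hl : (l : ℕ) < (B j).card then (((e ⟨l, hl⟩ : Fin n) : ℕ) : ℝ) ^ (t : ℕ)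
      else if (t : ℕ) = k then 1 else 0, fun i => ?_⟩
    have hfac : ∀ l : Fin d, (∑ t : Fin (k + 1), (if hl : (l : ℕ) < (B j).card then
        (((e ⟨l, hl⟩ : Fin n) : ℕ) : ℝ) ^ (t : ℕ) else if (t : ℕ) = k then 1 else 0) * cf i t) =
        (fun l : ℕ => if hl : l < (B j).card then (q i).eval (((e ⟨l, hl⟩ : Fin n) : ℕ) : ℝ)
          else 1) l := by
      intro l
      by_cases hl : (l : ℕ) < (B j).card
      · simp only [hl, dite_true, cf]
        rw [eval_eq_sum_range, hqd, Finset.sum_range]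
        exact Finset.sum_congr rfl fun t _ => mul_comm _ _
      · simp only [hl, dite_false, cf]
        rw [Fin.sum_univ_castSucc]
        have hc : (q i).coeff k = 1 := by
          have := hqm i
          rwa [Monic, leadingCoeff, hqd] at this
        simp [hc, fun t : Fin k => t.2.ne]
    rw [Finset.prod_congr rfl fun l _ => hfac l,
      Fin.prod_univ_eq_prod_range (fun l : ℕ => if hl : l < (B j).card then
        (q i).eval (((e ⟨l, hl⟩ : Fin n) : ℕ) : ℝ) else 1) d,
      ← Finset.prod_subset (Finset.range_subset_range.2 (hB j)), Finset.prod_range,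
      ← Finset.prod_coe_sort (B j),
      ← e.prod_comp]
    · exact Finset.prod_congr rfl fun l _ => by simp
    · intro l _ hl
      simp only [Finset.mem_range] at hl
      simp [hl]
  choose u hu using hu
  let f : ι → (Fin (k + 1) → ℝ) → ℝ := fun j c => ∏ l, ∑ t, u j l t * c t
  have hf0 : ∀ i j, f j (cf i) = 0 ↔ ¬ Disjoint (A i) (B j) := by
    intro i j
    rw [show f j (cf i) = _ from hu j i, Finset.prod_eq_zero_iff, Finset.not_disjoint_iff]
    constructor
    · rintro ⟨b, hb, h0⟩; exact ⟨b, (hq0 i b).1 h0, hb⟩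
    · rintro ⟨b, hb, h0⟩; exact ⟨b, h0, (hq0 i b).2 hb⟩
  have hli : LinearIndependent ℝ f := by
    rw [Fintype.linearIndependent_iff]
    intro g hg
    by_contra! hne
    obtain ⟨i₀, hi₀⟩ := hne
    -- Evaluating the relation at the `A i` of least `r` kills every other term with nonzero
    -- coefficient, by skewness.
    obtain ⟨i, hi, hmin⟩ := Finset.exists_min_image (Finset.univ.filter fun i => g i ≠ 0) r
      ⟨i₀, by simpa using hi₀⟩
    simp only [Finset.mem_filter, Finset.mem_univ, true_and] at hi hmin
    have hev := congrFun hg (cf i)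
    simp only [Finset.sum_apply, Pi.smul_apply, smul_eq_mul, Pi.zero_apply] at hev
    rw [Finset.sum_eq_single i] at hev
    · rcases mul_eq_zero.1 hev with h0 | h0
      · exact hi h0
      · exact (hf0 i i).1 h0 (hAB i)
    · intro j _ hj
      by_cases hgj : g j = 0
      · simp [hgj]
      · rw [(hf0 i j).2 (hskew i j hj.symm (hmin j hgj)), mul_zero]
    · simp
  have hcard := linearIndependent_le_span_aux' f hli
    (Set.range (symMonomial (m := k + 1) (d := d))) (by
      rintro _ ⟨j, rfl⟩
      exact prod_linear_mem_span (u j))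
  refine hcard.trans ((Fintype.card_range_le _).trans ?_)
  rw [Sym.card_sym_eq_choose, Fintype.card_fin]
  exact le_of_eq (by congr 1; omega)

end HeftArrangement

/-! ### The upper bound, from nearest points of polyhedra. -/

namespace HeftArrangement

open Set

variable {d n : ℕ} {h : Fin n → (EuclideanSpace ℝ (Fin d) →ᵃ[ℝ] ℝ)}

/-- The closed polyhedron on which every function outside `A` is at most `-ε`. -/
def negRegion (h : Fin n → (EuclideanSpace ℝ (Fin d) →ᵃ[ℝ] ℝ)) (ε : ℝ) (I : Finset (Fin n)) :
    Set (EuclideanSpace ℝ (Fin d)) :=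
  {y | ∀ i ∈ I, h i y ≤ -ε}

lemma negRegion_anti {ε : ℝ} {I J : Finset (Fin n)} (hIJ : I ⊆ J) :
    negRegion h ε J ⊆ negRegion h ε I :=
  fun _ hy i hi => hy i (hIJ hi)

lemma convex_halfspace (ε : ℝ) (i : Fin n) : Convex ℝ {y | h i y ≤ -ε} :=
  (convex_Iic (-ε)).affine_preimage (h i)

lemma negRegion_eq (ε : ℝ) (I : Finset (Fin n)) :
    negRegion h ε I = ⋂ i ∈ I, {y | h i y ≤ -ε} := by
  ext y; simp [negRegion]

lemma convex_negRegion (ε : ℝ) (I : Finset (Fin n)) : Convex ℝ (negRegion h ε I) := by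
  rw [negRegion_eq]
  exact convex_iInter₂ fun i _ => convex_halfspace ε i

lemma isClosed_negRegion (ε : ℝ) (I : Finset (Fin n)) : IsClosed (negRegion h ε I) := by
  rw [negRegion_eq]
  exact isClosed_biInter fun i _ => isClosed_le (continuous_affine i) continuous_const

/-- The distance from the origin to a polyhedron is already attained by at most `d` of its
inequalities. -/
lemma exists_card_le_negRegion_norm {ε : ℝ} {I : Finset (Fin n)}
    (hne : (negRegion h ε I).Nonempty) :
    ∃ v ∈ negRegion h ε I, ∃ B ⊆ I, B.card ≤ d ∧ ∀ y ∈ negRegion h ε B, ‖v‖ ≤ ‖y‖ := by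
  classical
  obtain ⟨v, hv, hdist⟩ := (isClosed_negRegion ε I).exists_infDist_eq_dist hne 0
  have hmin : ∀ y ∈ negRegion h ε I, ‖v‖ ≤ ‖y‖ := fun y hy => by
    have := Metric.infDist_le_dist_of_mem (x := 0) hy
    rwa [hdist, dist_zero_left, dist_zero_left] at this
  refine ⟨v, hv, ?_⟩
  by_contra! hcon
  -- Helly is applied to the half-spaces together with the open ball of radius `‖v‖`. Among at most
  -- `d + 1` members including the ball, at most `d` are half-spaces; without the ball, `v` is a
  -- common point.
  let F : Option (Fin n) → Set (EuclideanSpace ℝ (Fin d)) :=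
    fun o => o.elim (Metric.ball 0 ‖v‖) fun i => {y | h i y ≤ -ε}
  have hI : (⋂ o ∈ Finset.insertNone I, F o).Nonempty := by
    apply Convex.helly_theorem' (𝕜 := ℝ)
    · rintro (_ | i) _
      · exact convex_ball _ _
      · exact convex_halfspace ε i
    · intro J hJ hJc
      rw [finrank_euclideanSpace_fin] at hJc
      by_cases hnone : none ∈ J
      · have hBc : J.eraseNone.card ≤ d := by
          rw [Finset.card_eraseNone_eq_card_erase, Finset.card_erase_of_mem hnone]
          omega
        obtain ⟨y, hy, hyv⟩ := hcon J.eraseNone (fun i hi => by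
          simpa using hJ (Finset.mem_eraseNone.1 hi)) hBc
        refine ⟨y, mem_iInter₂.2 ?_⟩
        rintro (_ | i) hi
        · simpa [F] using hyv
        · exact hy i (Finset.mem_eraseNone.2 hi)
      · refine ⟨v, mem_iInter₂.2 ?_⟩
        rintro (_ | i) hi
        · exact absurd hi hnone
        · exact hv i (by simpa using hJ hi)
  obtain ⟨y, hy⟩ := hI
  rw [mem_iInter₂] at hy
  have hyv : y ∈ Metric.ball 0 ‖v‖ := hy none (by simp)
  rw [mem_ball_zero_iff] at hyv
  exact hyv.not_ge (hmin y fun i hi => hy (some i) (by simpa using hi))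

/-- The margin makes the regions closed, so nearest points exist while the inequalities stay strict.
It must be common to all `A` so that regions of different chambers are comparable; finiteness allows
this. -/
lemma exists_uniform_margin (𝒜 : Set (Finset (Fin n)))
    (h𝒜 : ∀ A ∈ 𝒜, ∃ x, (∀ i, h i x ≠ 0) ∧ posSet h x = A) :
    ∃ ε > 0, ∀ A ∈ 𝒜, (negRegion h ε Aᶜ).Nonempty := by
  have hev : ∀ A : Finset (Fin n), ∀ᶠ ε in nhdsWithin (0 : ℝ) (Ioi 0),
      A ∈ 𝒜 → (negRegion h ε Aᶜ).Nonempty := by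
    intro A
    by_cases hA : A ∈ 𝒜
    · obtain ⟨x, hx, rfl⟩ := h𝒜 A hA
      have hi : ∀ i, ∀ᶠ ε in nhdsWithin (0 : ℝ) (Ioi 0), h i x < 0 → h i x ≤ -ε := by
        intro i
        by_cases h0 : h i x < 0
        · have : ∀ᶠ ε in nhdsWithin (0 : ℝ) (Ioi 0), ε < -h i x :=
            nhdsWithin_le_nhds (gt_mem_nhds (by linarith))
          filter_upwards [this] with ε hε _
          linarith
        · exact Filter.Eventually.of_forall fun _ hh => absurd hh h0
      filter_upwards [Filter.eventually_all.2 hi] with ε hε _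
      refine ⟨x, fun i him => hε i (lt_of_le_of_ne ?_ (hx i))⟩
      simpa using him
    · exact Filter.Eventually.of_forall fun _ hh => absurd hh hA
  obtain ⟨ε, hε, hpos⟩ := ((Filter.eventually_all.2 hev).and self_mem_nhdsWithin).exists
  exact ⟨ε, hpos, fun A hA => hε A hA⟩

/-- The sets of positive indices of the chambers with heft `k`. -/
def heftFamily (h : Fin n → (EuclideanSpace ℝ (Fin d) →ᵃ[ℝ] ℝ)) (k : ℕ) : Set (Finset (Fin n)) :=
  {A | ∃ x, (∀ i, h i x ≠ 0) ∧ posSet h x = A ∧ A.card = k}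

lemma encard_chambers_heft_eq (k : ℕ) :
    Set.encard {C ∈ chambers h | heft h C = k} = (heftFamily h k).encard := by
  classical
  let φ : Set (EuclideanSpace ℝ (Fin d)) → Finset (Fin n) :=
    fun C => Finset.univ.filter fun i => C ⊆ positiveSide h i
  have hφ : ∀ x, (∀ i, h i x ≠ 0) → φ (cell h x) = posSet h x := fun x hx => by
    ext i
    simp [φ, cell_subset_positiveSide hx]
  have himg : φ '' {C ∈ chambers h | heft h C = k} = heftFamily h k := by
    ext A
    constructor
    · rintro ⟨C, ⟨hC, hCk⟩, rfl⟩
      obtain ⟨x, hx, rfl⟩ := mem_chambers.1 hC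
      rw [heft_cell hx] at hCk
      exact ⟨x, hx, (hφ x hx).symm, by rw [hφ x hx, hCk]⟩
    · rintro ⟨x, hx, rfl, hk⟩
      exact ⟨cell h x, ⟨mem_chambers.2 ⟨x, hx, rfl⟩, by rw [heft_cell hx, hk]⟩, hφ x hx⟩
  rw [← himg, Set.InjOn.encard_image]
  rintro C ⟨hC, -⟩ C' ⟨hC', -⟩ he
  obtain ⟨x, hx, rfl⟩ := mem_chambers.1 hC
  obtain ⟨x', hx', rfl⟩ := mem_chambers.1 hC'
  rw [hφ x hx, hφ x' hx'] at he
  exact (cell_eq_iff hx hx').2 he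

theorem card_heftFamily_le {k : ℕ} (hk : ∀ x, (∀ i, h i x ≠ 0) → k ≤ (posSet h x).card) :
    (heftFamily h k).encard ≤ ((d + k).choose d : ℕ) := by
  classical
  obtain ⟨ε, hε, hne⟩ := exists_uniform_margin (h := h) (heftFamily h k)
    fun A ⟨x, hx, hA, _⟩ => ⟨x, hx, hA⟩
  choose v hv B hBI hBc hBmin using fun A : heftFamily h k =>
    exists_card_le_negRegion_norm (hne A A.2)
  have hfin : (heftFamily h k).Finite := Set.toFinite _
  let _ : Fintype (heftFamily h k) := hfin.fintype
  have hdisj : ∀ A : heftFamily h k, Disjoint (A : Finset (Fin n)) (B A) := fun A =>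
    Finset.disjoint_left.2 fun i hi hiB => by simpa [hi] using hBI A hiB
  have hcard := card_le_of_skew_set_pairs (fun A : heftFamily h k => (A : Finset (Fin n))) B
    (fun A => ‖v A‖) (fun A => A.2.choose_spec.2.2) hBc hdisj (by
      intro A A' hne hle hdis
      have hsub : B A' ⊆ (A : Finset (Fin n))ᶜ := fun i hi =>
        Finset.mem_compl.2 (Finset.disjoint_right.1 hdis hi)
      have hvQ : v A ∈ negRegion h ε (B A') := negRegion_anti hsub (hv A)
      have hvQ' : v A' ∈ negRegion h ε (B A') := negRegion_anti (hBI A') (hv A')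
      have hnorm : ‖v A‖ = ‖v A'‖ := le_antisymm hle (hBmin A' _ hvQ)
      -- Otherwise the midpoint would lie in the region of `B A'` with norm below the minimum.
      have heq : v A = v A' := by
        by_contra hvne
        have hlt := (norm_midpoint_lt_iff hnorm).2 hvne
        refine hlt.not_ge (hnorm ▸ hBmin A' _ ?_)
        rw [smul_add]
        exact convex_negRegion ε (B A') hvQ hvQ' (by norm_num) (by norm_num) (by norm_num)
      obtain ⟨x, hx, hxA, hAk⟩ := A.2
      obtain ⟨x', hx', hxA', hAk'⟩ := A'.2
      obtain ⟨w, hw, hneg⟩ := exists_posSet_subset hx (v A)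
      have hsubset : ∀ D : heftFamily h k, v D = v A → posSet h w ⊆ D := by
        intro D hD i hi
        by_contra hiD
        have h1 := hv D i (Finset.mem_compl.2 hiD)
        rw [hD] at h1
        exact (mem_posSet.1 hi).not_gt (hneg i (by linarith))
      have h1 := Finset.eq_of_subset_of_card_le (hsubset A rfl) (hAk.trans_le (hk w hw))
      have h2 := Finset.eq_of_subset_of_card_le (hsubset A' heq.symm) (hAk'.trans_le (hk w hw))
      exact hne (Subtype.ext (h1.symm.trans h2)))
  rw [Set.encard_eq_coe_toFinset_card, Set.toFinset_card]
  exact_mod_cast hcard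

end HeftArrangement

/-! ### The extremal arrangement: genericity and the lower bound on heft. -/

namespace HeftArrangement

open Polynomial

/-- Evaluation at `t` of the polynomial of degree less than `d` with a given coefficient vector. -/
noncomputable def evalLinear (d : ℕ) (t : ℝ) : EuclideanSpace ℝ (Fin d) →ₗ[ℝ] ℝ :=
  ∑ j : Fin d, t ^ (j : ℕ) • (EuclideanSpace.proj j : EuclideanSpace ℝ (Fin d) →L[ℝ] ℝ).toLinearMap

lemma evalLinear_apply (d : ℕ) (t : ℝ) (x : EuclideanSpace ℝ (Fin d)) :
    evalLinear d t x = ∑ j : Fin d, t ^ (j : ℕ) * x j := by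
  simp [evalLinear]

/-- The monic polynomial of degree `d` with lower coefficients `x`. -/
noncomputable def monicPoly {d : ℕ} (x : EuclideanSpace ℝ (Fin d)) : ℝ[X] :=
  X ^ d + ∑ j : Fin d, C (x j) * X ^ (j : ℕ)

lemma monicPoly_monic {d : ℕ} (x : EuclideanSpace ℝ (Fin d)) : (monicPoly x).Monic :=
  monic_X_pow_add (degree_sum_fin_lt _)

lemma degree_monicPoly {d : ℕ} (x : EuclideanSpace ℝ (Fin d)) : (monicPoly x).degree = d := by
  rw [monicPoly, degree_add_eq_left_of_degree_lt, degree_X_pow]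
  rw [degree_X_pow]
  exact degree_sum_fin_lt _

lemma exists_monicPoly_eq {d : ℕ} {f : ℝ[X]} (hf : f.Monic) (hd : f.natDegree = d) :
    ∃ x : EuclideanSpace ℝ (Fin d), monicPoly x = f := by
  refine ⟨WithLp.toLp 2 fun j => f.coeff j, ?_⟩
  conv_rhs => rw [hf.as_sum, hd, Finset.sum_range]
  rfl

/-- Evaluation at `i` of monic polynomials of degree `d`, with a sign alternating in `i`. -/
noncomputable def altFunction (d i : ℕ) : EuclideanSpace ℝ (Fin d) →ᵃ[ℝ] ℝ :=
  (-1 : ℝ) ^ (d + i) • ((evalLinear d i).toAffineMap + AffineMap.const ℝ _ ((i : ℝ) ^ d))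

lemma altFunction_apply (d i : ℕ) (x : EuclideanSpace ℝ (Fin d)) :
    altFunction d i x = (-1) ^ (d + i) * (monicPoly x).eval (i : ℝ) := by
  have hsum : ∑ j : Fin d, (i : ℝ) ^ (j : ℕ) * x j = ∑ j : Fin d, x j * (i : ℝ) ^ (j : ℕ) :=
    Finset.sum_congr rfl fun j _ => mul_comm _ _
  have happ : altFunction d i x = (-1) ^ (d + i) * (evalLinear d i x + (i : ℝ) ^ d) := rfl
  rw [happ, evalLinear_apply, hsum]
  simp only [monicPoly, eval_add, eval_pow, eval_X, eval_finsetSum, eval_mul, eval_C]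
  ring

lemma altFunction_linear (d i : ℕ) :
    (altFunction d i).linear = (-1 : ℝ) ^ (d + i) • evalLinear d i := by
  ext x
  simp [altFunction]

lemma altFunction_linear_ne_zero {d : ℕ} (hd : 1 ≤ d) (i : ℕ) : (altFunction d i).linear ≠ 0 := by
  intro h0
  have := LinearMap.congr_fun h0 (EuclideanSpace.single (⟨0, hd⟩ : Fin d) (1 : ℝ))
  rw [altFunction_linear] at this
  simp [evalLinear_apply] at this

lemma altFunction_eq_zero_iff (d i : ℕ) (x : EuclideanSpace ℝ (Fin d)) :
    altFunction d i x = 0 ↔ (monicPoly x).eval (i : ℝ) = 0 := by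
  simp [altFunction_apply]

/-- Evaluations at at most `d` nodes are linearly independent on polynomials of degree less than
`d`. -/
lemma evalLinear_pi_surjective {d : ℕ} (S : Finset ℕ) (hS : S.card ≤ d) :
    Function.Surjective (LinearMap.pi fun i : S => evalLinear d ((i : ℕ) : ℝ)) := by
  classical
  intro y
  have hinj : Set.InjOn (fun i : ℕ => (i : ℝ)) S := fun a _ b _ hab => Nat.cast_injective hab
  let p := Lagrange.interpolate S (fun i : ℕ => (i : ℝ)) fun i => if hi : i ∈ S then y ⟨i, hi⟩ else 0
  have hp : p.degree < d :=
    (Lagrange.degree_interpolate_lt _ hinj).trans_le (by exact_mod_cast hS)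
  refine ⟨WithLp.toLp 2 fun j => p.coeff j, ?_⟩
  ext i
  have hi := Lagrange.eval_interpolate_at_node
    (fun i => if hi : i ∈ S then y ⟨i, hi⟩ else 0) hinj i.2
  simp only [i.2, dite_true] at hi
  rw [LinearMap.pi_apply, evalLinear_apply, ← hi]
  have hev : p.eval ((i : ℕ) : ℝ) = ∑ j ∈ Finset.range d, p.coeff j * ((i : ℕ) : ℝ) ^ j := by
    by_cases hp0 : p = 0
    · simp [hp0]
    · exact eval_eq_sum_range' ((natDegree_lt_iff_degree_lt hp0).2 hp) _
  change _ = p.eval ((i : ℕ) : ℝ)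
  rw [hev, Finset.sum_range]
  exact Finset.sum_congr rfl fun j _ => mul_comm _ _

/-- A nonzero polynomial of degree `d` has at most `d` roots, so at most `d` hyperplanes share a
point. Their linear parts are independent by interpolation, so each one lowers the dimension of the
intersection by one. -/
lemma isGeneric_altFunction (d n : ℕ) : IsGeneric fun i : Fin n => altFunction d i := by
  classical
  intro p _ hpd P ⟨x, hx⟩ hfr
  let S : Finset (Fin n) := Finset.univ.filter fun i =>
    (P : Set (EuclideanSpace ℝ (Fin d))) ⊆ hyperplane (fun i : Fin n => altFunction d i) i
  have hS : {i : Fin n | (P : Set (EuclideanSpace ℝ (Fin d))) ⊆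
      hyperplane (fun i : Fin n => altFunction d i) i} = S := by ext; simp [S]
  rw [hS, Set.ncard_coe_finset]
  let S' : Finset ℕ := S.map Fin.valEmbedding
  have hcard : S'.card = S.card := Finset.card_map _
  have hzero : ∀ i ∈ S', ∀ y ∈ P, altFunction d i y = 0 := by
    intro i hi y hy
    obtain ⟨a, ha, rfl⟩ := Finset.mem_map.1 hi
    exact (Finset.mem_filter.1 ha).2 hy
  have hle : S'.card ≤ d := by
    by_contra! hlt
    refine (monicPoly_monic x).ne_zero (Polynomial.eq_zero_of_degree_lt_of_eval_index_eq_zero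
      (s := S') (v := fun i : ℕ => (i : ℝ))
      (fun a _ b _ hab => Nat.cast_injective hab) ?_
      fun i hi => (altFunction_eq_zero_iff d i x).1 (hzero i hi x hx))
    rw [degree_monicPoly]
    exact_mod_cast hlt
  let Φ := LinearMap.pi fun i : S' => evalLinear d ((i : ℕ) : ℝ)
  have hrange : Module.finrank ℝ (LinearMap.range Φ) = S'.card := by
    rw [LinearMap.range_eq_top.2 (evalLinear_pi_surjective S' hle), finrank_top]
    simp
  have hrank := LinearMap.finrank_range_add_finrank_ker Φ
  rw [hrange, finrank_euclideanSpace_fin] at hrank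
  have hdir : P.direction ≤ LinearMap.ker Φ := by
    intro v hv
    rw [LinearMap.mem_ker]
    ext i
    have h1 := hzero i i.2 (v +ᵥ x) (AffineSubspace.vadd_mem_of_mem_direction hv hx)
    rw [AffineMap.map_vadd, hzero i i.2 x hx, altFunction_linear] at h1
    change evalLinear d ((i : ℕ) : ℝ) v = 0
    simpa using h1
  have := Submodule.finrank_mono hdir
  omega

/-- A finite set of naturals can be avoided by stepping by two, at a cost of two per element. -/
lemma exists_notMem_of_parity (A : Finset ℕ) (x : ℕ) :
    ∃ y, x ≤ y ∧ y % 2 = x % 2 ∧ y ∉ A ∧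
      y + 2 * (A.filter (· < x)).card ≤ x + 2 * (A.filter (· < y)).card := by
  induction hm : (A.filter (x ≤ ·)).card using Nat.strong_induction_on generalizing x with
  | _ m ih =>
    by_cases hx : x ∈ A
    · have hss : A.filter (x + 2 ≤ ·) ⊂ A.filter (x ≤ ·) := by
        refine Finset.ssubset_iff_of_subset (fun a ha => ?_) |>.2
          ⟨x, by simp [hx], by simp⟩
        simp only [Finset.mem_filter] at ha ⊢
        exact ⟨ha.1, by omega⟩
      obtain ⟨y, h1, h2, h3, h4⟩ := ih _ (hm ▸ Finset.card_lt_card hss) (x + 2) rfl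
      have hlt : (A.filter (· < x)).card < (A.filter (· < x + 2)).card := by
        refine Finset.card_lt_card (Finset.ssubset_iff_of_subset (fun a ha => ?_) |>.2
          ⟨x, by simp [hx], by simp⟩)
        simp only [Finset.mem_filter] at ha ⊢
        exact ⟨ha.1, by omega⟩
      exact ⟨y, by omega, by omega, h3, by omega⟩
    · exact ⟨x, le_rfl, rfl, hx, le_rfl⟩

/-- Greedy choice: each next node is the first admissible one of the right parity, and every element
of `A` costs at most one extra step of two. -/
lemma exists_alternating_avoiding (A : Finset ℕ) :
    ∃ e : ℕ → ℕ, StrictMono e ∧ ∀ j, e j % 2 = j % 2 ∧ e j ∉ A ∧ e j ≤ j + 2 * A.card := by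
  choose Y h1 h2 h3 h4 using exists_notMem_of_parity A
  obtain ⟨e, h0, hs⟩ : ∃ e : ℕ → ℕ, e 0 = Y 0 ∧ ∀ j, e (j + 1) = Y (e j + 1) :=
    ⟨fun j => Nat.rec (Y 0) (fun _ t => Y (t + 1)) j, rfl, fun _ => rfl⟩
  have key : ∀ j : ℕ, e j % 2 = j % 2 ∧ e j ∉ A ∧ e j ≤ j + 2 * (A.filter fun a => a < e j).card := by
    intro j
    induction j with
    | zero => exact h0 ▸ ⟨h2 0, h3 0, by simpa using h4 0⟩
    | succ j ih =>
      rw [hs]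
      refine ⟨by have := h2 (e j + 1); omega, h3 _, ?_⟩
      have ha := h4 (e j + 1)
      have hb : (A.filter (· < e j)).card ≤ (A.filter (· < e j + 1)).card := by
        refine Finset.card_le_card fun a ha => ?_
        simp only [Finset.mem_filter] at ha ⊢
        exact ⟨ha.1, by omega⟩
      omega
  refine ⟨e, strictMono_nat_of_lt_succ fun j => ?_, fun j => ⟨(key j).1, (key j).2.1, ?_⟩⟩
  · rw [hs]
    exact h1 (e j + 1)
  · have := Finset.card_filter_le A fun a => a < e j
    have := (key j).2.2
    omega

/-- A monic polynomial of degree `d` cannot have the signs opposite to those of the weights of the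
leading coefficient formula at `d + 1` increasing nodes. -/
lemma exists_altFunction_nonneg {d : ℕ} (x : EuclideanSpace ℝ (Fin d)) {e : ℕ → ℕ}
    (he : StrictMono e) (hpar : ∀ j, e j % 2 = j % 2) :
    ∃ j ≤ d, 0 ≤ altFunction d (e j) x := by
  by_contra! hneg
  have hlead := Lagrange.leadingCoeff_eq_sum (s := Finset.range (d + 1))
    (v := fun j => ((e j : ℕ) : ℝ)) (fun a _ b _ hab => he.injective (Nat.cast_injective hab))
    (P := monicPoly x) (by rw [degree_monicPoly]; simp)
  rw [monicPoly_monic x] at hlead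
  refine absurd hlead (ne_of_gt ?_)
  refine lt_of_le_of_lt (Finset.sum_nonpos fun j hj => ?_) one_pos
  have hj' : j ≤ d := Nat.lt_succ_iff.1 (Finset.mem_range.1 hj)
  have hsplit : (Finset.range (d + 1)).erase j = Finset.range j ∪ Finset.Ioc j d := by
    ext a
    simp only [Finset.mem_erase, Finset.mem_range, Finset.mem_union, Finset.mem_Ioc]
    omega
  have hdis : Disjoint (Finset.range j) (Finset.Ioc j d) :=
    Finset.disjoint_left.2 fun a ha hb => by
      simp only [Finset.mem_range, Finset.mem_Ioc] at ha hb
      omega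
  have hprod : ∏ l ∈ (Finset.range (d + 1)).erase j, ((e j : ℝ) - (e l : ℝ)) =
      (-1) ^ (d - j) * ((∏ l ∈ Finset.range j, ((e j : ℝ) - e l)) *
        ∏ l ∈ Finset.Ioc j d, ((e l : ℝ) - e j)) := by
    rw [hsplit, Finset.prod_union hdis]
    have : ∏ l ∈ Finset.Ioc j d, ((e j : ℝ) - e l) =
        (-1) ^ (d - j) * ∏ l ∈ Finset.Ioc j d, ((e l : ℝ) - e j) := by
      rw [← Nat.card_Ioc j d, ← Finset.prod_const, ← Finset.prod_mul_distrib]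
      exact Finset.prod_congr rfl fun l _ => by ring
    rw [this]
    ring
  have hpos : 0 < (∏ l ∈ Finset.range j, ((e j : ℝ) - e l)) *
      ∏ l ∈ Finset.Ioc j d, ((e l : ℝ) - e j) := by
    refine mul_pos (Finset.prod_pos fun l hl => ?_) (Finset.prod_pos fun l hl => ?_)
    · exact sub_pos.2 (by exact_mod_cast he (Finset.mem_range.1 hl))
    · exact sub_pos.2 (by exact_mod_cast he (Finset.mem_Ioc.1 hl).1)
  -- Since `e j` and `j` have equal parity, the alternating sign is that of the Lagrange
  -- denominator, so every summand is nonpositive.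
  have hsign : (-1 : ℝ) ^ (d + e j) = (-1) ^ (d - j) := by
    rw [neg_one_pow_eq_pow_mod_two, neg_one_pow_eq_pow_mod_two (n := d - j)]
    have := hpar j
    congr 1
    omega
  have hval := hneg j hj'
  rw [altFunction_apply, hsign] at hval
  rw [hprod]
  have hsq : ((-1 : ℝ) ^ (d - j)) * (-1) ^ (d - j) = 1 := by
    rw [← mul_pow]; simp
  set σ : ℝ := (-1) ^ (d - j)
  have hrw : (monicPoly x).eval (e j : ℝ) = σ * (σ * (monicPoly x).eval (e j : ℝ)) := by
    rw [← mul_assoc, hsq, one_mul]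
  have hσ : σ ≠ 0 := fun h0 => by simp [h0] at hsq
  rw [hrw, mul_div_mul_left _ _ hσ]
  exact (div_neg_of_neg_of_pos hval hpos).le

lemma le_card_posSet_altFunction {d k n : ℕ} (hn : n + 1 = 2 * k + d)
    {x : EuclideanSpace ℝ (Fin d)} (hx : ∀ i : Fin n, altFunction d i x ≠ 0) :
    k ≤ (posSet (fun i : Fin n => altFunction d i) x).card := by
  by_contra! hlt
  let A := (posSet (fun i : Fin n => altFunction d i) x).map Fin.valEmbedding
  have hA : A.card < k := by simpa [A] using hlt
  obtain ⟨e, he, hkey⟩ := exists_alternating_avoiding A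
  obtain ⟨j, hj, hnn⟩ := exists_altFunction_nonneg x he fun j => (hkey j).1
  -- `e j ≤ d + 2 * (k - 1) = n - 1`, which is what fixes the number of nodes.
  have hjn : e j < n := by have := (hkey j).2.2; omega
  refine (hkey j).2.1 (Finset.mem_map.2 ⟨⟨e j, hjn⟩, mem_posSet.2 ?_, rfl⟩)
  exact lt_of_le_of_ne hnn (hx ⟨e j, hjn⟩).symm

end HeftArrangement

/-! ### Chambers of heft `k` from `k`-subsets of `range (d + k)`. -/

namespace HeftArrangement

open Polynomial

/-- The number of nodes used up by the letters before `c`, where letters in `T` use two nodes and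
the others one. -/
def gap (T : Finset ℕ) (c : ℕ) : ℕ := c + (T.filter (· < c)).card

lemma card_filter_lt_succ (T : Finset ℕ) (c : ℕ) :
    (T.filter (· < c + 1)).card = (T.filter (· < c)).card + if c ∈ T then 1 else 0 := by
  classical
  split_ifs with hc
  · have : T.filter (· < c + 1) = insert c (T.filter (· < c)) := by
      ext a
      simp only [Finset.mem_filter, Finset.mem_insert]
      constructor
      · rintro ⟨h1, h2⟩
        rcases Nat.lt_succ_iff_lt_or_eq.1 h2 with h3 | h3
        · exact Or.inr ⟨h1, h3⟩
        · exact Or.inl h3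
      · rintro (rfl | ⟨h1, h2⟩)
        · exact ⟨hc, by omega⟩
        · exact ⟨h1, by omega⟩
    rw [this, Finset.card_insert_of_notMem (by simp)]
  · rw [add_zero]
    congr 1
    refine Finset.filter_congr fun a ha => ?_
    have : a ≠ c := fun hac => hc (hac ▸ ha)
    omega

lemma gap_succ (T : Finset ℕ) (c : ℕ) :
    gap T (c + 1) = gap T c + 1 + if c ∈ T then 1 else 0 := by
  rw [gap, gap, card_filter_lt_succ]
  ring

lemma gap_strictMono (T : Finset ℕ) : StrictMono (gap T) :=
  strictMono_nat_of_lt_succ fun c => by rw [gap_succ]; omega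

lemma gap_congr {T T' : Finset ℕ} {c : ℕ} (h : ∀ a < c, a ∈ T ↔ a ∈ T') : gap T c = gap T' c := by
  rw [gap, gap]
  congr 2
  ext a
  simp only [Finset.mem_filter]
  constructor
  · rintro ⟨h1, h2⟩; exact ⟨(h a h2).1 h1, h2⟩
  · rintro ⟨h1, h2⟩; exact ⟨(h a h2).2 h1, h2⟩

/-- `gap T c` depends only on the elements of `T` below `c`, so membership of `c` can be decoded
inductively from the image. -/
lemma image_gap_injective : Function.Injective fun T : Finset ℕ => T.image (gap T) := by
  intro T T' hTT
  simp only at hTT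
  ext c
  induction c using Nat.strong_induction_on with
  | _ c ih =>
    have hg := gap_congr ih
    have hm : ∀ S : Finset ℕ, gap S c ∈ S.image (gap S) ↔ c ∈ S := fun S =>
      ⟨fun hc => by
        obtain ⟨b, hb, hbc⟩ := Finset.mem_image.1 hc
        exact (gap_strictMono S).injective hbc ▸ hb, Finset.mem_image_of_mem _⟩
    rw [← hm T, ← hm T', hTT, hg]

lemma gap_eq_of_subset_range {T : Finset ℕ} {m : ℕ} (hT : T ⊆ Finset.range m) :
    gap T m = m + T.card := by
  rw [gap, Finset.filter_true_of_mem fun a ha => Finset.mem_range.1 (hT ha)]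

lemma exists_gap_le_lt (T : Finset ℕ) (i : ℕ) : ∃ c, gap T c ≤ i ∧ i < gap T (c + 1) := by
  have hex : ∃ c, i < gap T (c + 1) :=
    ⟨i, (Nat.lt_succ_self i).trans_le ((gap_strictMono T).id_le _)⟩
  refine ⟨Nat.find hex, ?_, Nat.find_spec hex⟩
  rcases hc : Nat.find hex with _ | c
  · simp [gap]
  · exact not_lt.1 (Nat.find_min hex (m := c) (by omega))

/-- The monic polynomial with a root just before each node `gap T c` with `c < m` outside `T`. -/
noncomputable def gapPoly (T : Finset ℕ) (m : ℕ) : ℝ[X] :=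
  ∏ c ∈ Finset.range m \ T, (X - C ((gap T c : ℝ) - 1 / 2))

lemma gapPoly_monic (T : Finset ℕ) (m : ℕ) : (gapPoly T m).Monic :=
  monic_prod_of_monic _ _ fun _ _ => monic_X_sub_C _

lemma natDegree_gapPoly {T : Finset ℕ} {m : ℕ} (hT : T ⊆ Finset.range m) :
    (gapPoly T m).natDegree = m - T.card := by
  rw [gapPoly, natDegree_prod_of_monic _ _ fun _ _ => monic_X_sub_C _]
  simp only [natDegree_X_sub_C, Finset.sum_const, smul_eq_mul, mul_one]
  rw [Finset.card_sdiff_of_subset hT, Finset.card_range]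

lemma eval_gapPoly_ne_zero (T : Finset ℕ) (m i : ℕ) : (gapPoly T m).eval (i : ℝ) ≠ 0 := by
  simp only [gapPoly, eval_prod, eval_sub, eval_X, eval_C]
  refine Finset.prod_ne_zero_iff.2 fun c _ h0 => ?_
  have : (2 * i + 1 : ℝ) = 2 * gap T c := by linarith
  have : 2 * i + 1 = 2 * gap T c := by exact_mod_cast this
  omega

lemma sign_eval_gapPoly (T : Finset ℕ) (m i : ℕ) :
    0 < (-1 : ℝ) ^ ((Finset.range m \ T).filter fun c => i < gap T c).card *
      (gapPoly T m).eval (i : ℝ) := by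
  have hpow : (-1 : ℝ) ^ ((Finset.range m \ T).filter fun c => i < gap T c).card =
      ∏ c ∈ Finset.range m \ T, if i < gap T c then (-1 : ℝ) else 1 := by
    rw [Finset.prod_ite, Finset.prod_const, Finset.prod_const_one, mul_one]
  rw [hpow, gapPoly, eval_prod, ← Finset.prod_mul_distrib]
  refine Finset.prod_pos fun c _ => ?_
  simp only [eval_sub, eval_X, eval_C]
  split_ifs with hlt
  · have : (i : ℝ) + 1 ≤ gap T c := by exact_mod_cast hlt
    linarith
  · have : (gap T c : ℝ) ≤ i := by exact_mod_cast not_lt.1 hlt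
    linarith

/-- At the nodes outside `gap T '' T` the alternating sign of `gapPoly T m` is negative. -/
lemma alternating_gapPoly_neg {T : Finset ℕ} {d m i : ℕ} (hT : T ⊆ Finset.range m)
    (hm : T.card + d = m) (hi : i < m + T.card) (hiT : i ∉ T.image (gap T)) :
    (-1 : ℝ) ^ (d + i) * (gapPoly T m).eval (i : ℝ) < 0 := by
  classical
  obtain ⟨c, hc, hc'⟩ := exists_gap_le_lt T i
  have hcm : c < m := (gap_strictMono T).lt_iff_lt.1
    (hc.trans_lt (hi.trans_eq (gap_eq_of_subset_range hT).symm))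
  set N := ((Finset.range m \ T).filter fun c => i < gap T c).card with hN
  -- `N` counts the roots to the right of `i`; they belong to the letters after `c` that lie outside
  -- `T`.
  have hcount : N + (c + 1) = d + (T.filter (· < c + 1)).card := by
    have h1 : (Finset.range m \ T).filter (fun b => i < gap T b) =
        (Finset.range m \ T) \ (Finset.range (c + 1) \ T) := by
      ext b
      have hb : i < gap T b ↔ c + 1 ≤ b := by
        constructor
        · intro h
          exact (gap_strictMono T).lt_iff_lt.1 (hc.trans_lt h)
        · intro h
          exact hc'.trans_le ((gap_strictMono T).monotone h)
      simp only [Finset.mem_filter, Finset.mem_sdiff, Finset.mem_range, hb]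
      constructor
      · rintro ⟨h1, h2⟩; exact ⟨h1, fun h3 => by omega⟩
      · rintro ⟨h1, h2⟩; exact ⟨h1, by by_contra h3; exact h2 ⟨by omega, h1.2⟩⟩
    have h2 : Finset.range (c + 1) \ T ⊆ Finset.range m \ T :=
      Finset.sdiff_subset_sdiff (Finset.range_subset_range.2 hcm) subset_rfl
    have h3 := Finset.card_sdiff_add_card_eq_card h2
    have h4 := Finset.card_sdiff_add_card_eq_card hT
    have h5 := Finset.card_sdiff_add_card_inter (Finset.range (c + 1)) T
    have h6 : Finset.range (c + 1) ∩ T = T.filter (· < c + 1) := by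
      ext b; simp [and_comm]
    rw [← h1, ← hN] at h3
    rw [h6] at h5
    rw [Finset.card_range] at h4 h5
    omega
  have hpar : (d + i + N) % 2 = 1 := by
    rw [card_filter_lt_succ] at hcount
    rw [gap_succ] at hc'
    have hgap : gap T c = c + (T.filter (· < c)).card := rfl
    by_cases hcT : c ∈ T
    -- Excluding its first node, `i` is the second node of the double letter `c`.
    · have hne : i ≠ gap T c := fun h => hiT (h ▸ Finset.mem_image_of_mem _ hcT)
      simp only [hcT, if_true] at hcount hc'
      omega
    · simp only [hcT, if_false] at hcount hc'
      omega
  have hs := sign_eval_gapPoly T m i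
  rw [← hN] at hs
  have hpow : (-1 : ℝ) ^ (d + i) = -(-1) ^ N := by
    have h1 : (-1 : ℝ) ^ (d + i) * (-1) ^ N = -1 := by
      rw [← pow_add, Odd.neg_one_pow (Nat.odd_iff.2 hpar)]
    have h2 : (-1 : ℝ) ^ N * (-1) ^ N = 1 := by rw [← mul_pow]; simp
    linear_combination (-1 : ℝ) ^ N * h1 - (-1 : ℝ) ^ (d + i) * h2
  rw [hpow]
  linarith

lemma le_encard_heftFamily_altFunction {d k n : ℕ} (hn : n + 1 = 2 * k + d) :
    ((d + k).choose d : ℕ) ≤ (heftFamily (fun i : Fin n => altFunction d i) k).encard := by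
  classical
  have hex : ∀ T ∈ Finset.powersetCard k (Finset.range (d + k)),
      ∃ x : EuclideanSpace ℝ (Fin d), (∀ i : Fin n, altFunction d i x ≠ 0) ∧
        (posSet (fun i : Fin n => altFunction d i) x).map Fin.valEmbedding = T.image (gap T) := by
    intro T hT
    obtain ⟨hTs, hTk⟩ := Finset.mem_powersetCard.1 hT
    obtain ⟨x, hx⟩ := exists_monicPoly_eq (gapPoly_monic T (d + k)) (d := d) (by
      rw [natDegree_gapPoly hTs, hTk, Nat.add_sub_cancel])
    have hne : ∀ i : Fin n, altFunction d i x ≠ 0 := fun i => by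
      rw [Ne, altFunction_eq_zero_iff, hx]
      exact eval_gapPoly_ne_zero _ _ _
    -- Only the inclusion needs the sign computation; equality follows because the heft is at least
    -- `k`, the size of the image.
    refine ⟨x, hne, Finset.eq_of_subset_of_card_le ?_ ?_⟩
    · intro a ha
      obtain ⟨i, hi, rfl⟩ := Finset.mem_map.1 ha
      by_contra hiT
      have hpos := mem_posSet.1 hi
      simp only [altFunction_apply, hx] at hpos
      have hin := i.2
      exact hpos.not_gt (alternating_gapPoly_neg hTs (by omega) (by omega) hiT)
    · rw [Finset.card_map, Finset.card_image_of_injective _ (gap_strictMono T).injective, hTk]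
      exact le_card_posSet_altFunction hn hne
  choose! x hx0 hxT using hex
  let Ψ : Finset ℕ → Finset (Fin n) := fun T => posSet (fun i : Fin n => altFunction d i) (x T)
  have hinj : Set.InjOn Ψ (Finset.powersetCard k (Finset.range (d + k))) := by
    intro T hT T' hT' he
    apply image_gap_injective
    simp only
    rw [← hxT T hT, ← hxT T' hT']
    exact congrArg _ he
  have hsub : (((Finset.powersetCard k (Finset.range (d + k))).image Ψ : Finset _) :
      Set (Finset (Fin n))) ⊆ heftFamily (fun i : Fin n => altFunction d i) k := by
    intro A hA
    obtain ⟨T, hT, rfl⟩ := Finset.mem_image.1 hA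
    refine ⟨x T, hx0 T hT, rfl, ?_⟩
    rw [← Finset.card_map Fin.valEmbedding, hxT T hT,
      Finset.card_image_of_injective _ (gap_strictMono T).injective]
    exact (Finset.mem_powersetCard.1 hT).2
  refine le_trans (le_of_eq ?_) (Set.encard_le_encard hsub)
  rw [Set.encard_coe_eq_coe_finsetCard, Finset.card_image_of_injOn hinj,
    Finset.card_powersetCard, Finset.card_range, Nat.choose_symm_add]

lemma le_heft_iff {d n k : ℕ} {h : Fin n → (EuclideanSpace ℝ (Fin d) →ᵃ[ℝ] ℝ)} :
    (∀ C ∈ chambers h, k ≤ heft h C) ↔ ∀ x, (∀ i, h i x ≠ 0) → k ≤ (posSet h x).card := by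
  constructor
  · intro hk x hx
    rw [← heft_cell hx]
    exact hk _ (mem_chambers.2 ⟨x, hx, rfl⟩)
  · intro hk C hC
    obtain ⟨x, hx, rfl⟩ := mem_chambers.1 hC
    rw [heft_cell hx]
    exact hk x hx

end HeftArrangement

theorem theorem4p4 (d k : ℕ) :
    (∀ (n : ℕ) (h : Fin n → (EuclideanSpace ℝ (Fin d) →ᵃ[ℝ] ℝ)),
      (∀ i, (h i).linear ≠ 0) →
      HeftArrangement.IsGeneric h →
      (∀ C ∈ HeftArrangement.chambers h, k ≤ HeftArrangement.heft h C) →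
      Set.encard {C ∈ HeftArrangement.chambers h | HeftArrangement.heft h C = k} ≤
        ((Nat.choose (d + k) d : ℕ) : ℕ∞)) ∧
    (1 ≤ d →
      ∃ (n : ℕ) (h : Fin n → (EuclideanSpace ℝ (Fin d) →ᵃ[ℝ] ℝ)),
        (∀ i, (h i).linear ≠ 0) ∧
        HeftArrangement.IsGeneric h ∧
        (∀ C ∈ HeftArrangement.chambers h, k ≤ HeftArrangement.heft h C) ∧
        Set.encard {C ∈ HeftArrangement.chambers h | HeftArrangement.heft h C = k} =
          ((Nat.choose (d + k) d : ℕ) : ℕ∞)) := by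

  open HeftArrangement in
  refine ⟨fun n h _ _ hk => ?_, fun hd => ?_⟩
  · rw [encard_chambers_heft_eq]
    exact card_heftFamily_le (le_heft_iff.1 hk)
  -- `1 ≤ d` keeps the natural subtraction exact, also for `k = 0`.
  · have hn : 2 * k + d - 1 + 1 = 2 * k + d := by omega
    have hk : ∀ x, (∀ i : Fin (2 * k + d - 1), altFunction d i x ≠ 0) →
        k ≤ (posSet (fun i : Fin (2 * k + d - 1) => altFunction d i) x).card :=
      fun x hx => le_card_posSet_altFunction hn hx
    refine ⟨2 * k + d - 1, fun i => altFunction d i, fun i => altFunction_linear_ne_zero hd i,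
      isGeneric_altFunction d _, le_heft_iff.2 hk, ?_⟩
    rw [encard_chambers_heft_eq]
    exact le_antisymm (card_heftFamily_le hk) (le_encard_heftFamily_altFunction hn)
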